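/- Let $k$ be a field and let $\mathcal C$ be a skeletally small, Hom-finite, Krull–Schmidt, triangulated $k$-category with suspension $\Sigma$ and with Serre duality, i.e. with an autoequivalence $\nu$ of $\mathcal C$ and $k$-linear isomorphisms $\operatorname{Hom}_{\mathcal C}(X,Y)\simeq \operatorname{Hom}_k(\operatorname{Hom}_{\mathcal C}(Y,\nu X),k)$, natural in $X$ and $Y$. Let $T$ be a rigid object of $\mathcal C$, i.e. $\operatorname{Hom}_{\mathcal C}(T,\Sigma T)=0$. Let $\mathcal X_T$ be the class of objects $X$ with $\operatorname{Hom}_{\mathcal C}(T,X)=0$, and let $Q\colon\mathcal C\to\mathcal C/\mathcal X_T$ be the quotient of $\mathcal C$ by the ideal of morphisms factoring through an object of $\mathcal X_T$. Let $\mathcal R$ be the class of regular morphisms (those that are both monomorphisms and epimorphisms) of $\mathcal C/\mathcal X_T$, and let $L_{\mathcal R}\colon\mathcal C/\mathcal X_T\to(\mathcal C/\mathcal X_T)_{\mathcal R}$ be the Gabriel–Zisman localisation at $\mathcal R$. Write $\operatorname{mod}\operatorname{End}_{\mathcal C}(T)^{op}$ for the category of finitely generated left modules over $\operatorname{End}_{\mathcal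 C}(T)^{op}$. The functor $H=\operatorname{Hom}_{\mathcal C}(T,-)\colon\mathcal C\to\operatorname{mod}\operatorname{End}_{\mathcal C}(T)^{op}$ factors uniquely as $H=H'L_{\mathcal R}Q$ for a functor $H'\colon(\mathcal C/\mathcal X_T)_{\mathcal R}\to\operatorname{mod}\operatorname{End}_{\mathcal C}(T)^{op}$. Then $(\mathcal C/\mathcal X_T)_{\mathcal R}$ has an additive structure on its Hom-sets for which $L_{\mathcal R}$ is an additive functor. For any such structure, regard $\operatorname{Hom}_{(\mathcal C/\mathcal X_T)_{\mathcal R}}(T,-)$ as a functor to $\operatorname{End}_{\mathcal C}(T)^{op}$-modules through the ring homomorphism $\operatorname{End}_{\mathcal C}(T)\to\operatorname{End}_{(\mathcal C/\mathcal X_T)_{\mathcal R}}(T)$ induced by $L_{\mathcal R}Q$. Then $H'$ is naturally isomorphic to $\operatorname{Hom}_{(\mathcal C/\mathcal X_T)_{\mathcal R}}(T,-)$, and the latter gives an equivalence between $(\mathcal C/\mathcal X_T)_{\mathcal R}$ and $\operatorname{mod}\operatorname{End}_{\mathcal C}(T)^{op}$. Hence $H'$ is an equivalence of categories. -/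

import Mathlib

open CategoryTheory CategoryTheory.Limits

universe w v u

namespace RigidLocalisation

noncomputable section

section Assumptions

/-- Every object is a finite direct sum of objects with local endomorphism rings. -/
def IsKrullSchmidt (C : Type u) [Category.{v} C] [Preadditive C] [HasFiniteBiproducts C] : Prop :=
  ∀ X : C, ∃ (n : ℕ) (Y : Fin n → C),
    (∀ i, IsLocalRing (End (Y i))) ∧ Nonempty (X ≅ ⨁ Y)

/-- There are an autoequivalence `ν` of `C` and `k`-linear isomorphisms
`Hom(X, Y) ≃ Hom_k(Hom(Y, ν X), k)`, natural in `X` and `Y`. -/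
def HasSerreDuality (k : Type w) [Field k] (C : Type u) [Category.{v} C] [Preadditive C]
    [Linear k C] : Prop :=
  ∃ (ν : C ≌ C) (φ : ∀ X Y : C, (X ⟶ Y) ≃ₗ[k] Module.Dual k (Y ⟶ ν.functor.obj X)),
    ∀ ⦃X' X Y Y' : C⦄ (a : X' ⟶ X) (f : X ⟶ Y) (b : Y ⟶ Y') (g : Y' ⟶ ν.functor.obj X'),
      φ X' Y' (a ≫ f ≫ b) g = φ X Y f (b ≫ g ≫ ν.functor.map a)

/-- `T` is rigid: `Ext¹(T, T) = Hom(T, Σ T) = 0`. -/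
def IsRigid {C : Type u} [Category.{v} C] [Preadditive C] [HasShift C ℤ] (T : C) : Prop :=
  ∀ f : T ⟶ T⟦(1 : ℤ)⟧, f = 0

end Assumptions

section FactorCategory

variable {C : Type u} [Category.{v} C] [Preadditive C]

/-- The class `𝒳_T` of the objects `X` with `Hom(T, X) = 0`. -/
def perp (T : C) : ObjectProperty C := fun X => ∀ f : T ⟶ X, f = 0

/-- Two parallel morphisms are identified if their difference factors through an object
of `𝒳_T`. -/
def factorRel (T : C) : HomRel C := fun X Y f g =>
  ∃ (U : C) (a : X ⟶ U) (b : U ⟶ Y), perp T U ∧ f - g = a ≫ b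

lemma factorRel_add [HasBinaryBiproducts C] (T : C) ⦃X Y : C⦄ (f₁ f₂ g₁ g₂ : X ⟶ Y)
    (h : factorRel T f₁ f₂) (h' : factorRel T g₁ g₂) :
    factorRel T (f₁ + g₁) (f₂ + g₂) := by
  obtain ⟨U, a, b, hU, e⟩ := h
  obtain ⟨U', a', b', hU', e'⟩ := h'
  refine ⟨U ⊞ U', biprod.lift a a', biprod.desc b b', fun f => ?_, ?_⟩
  · apply biprod.hom_ext
    · simpa using hU (f ≫ biprod.fst)
    · simpa using hU' (f ≫ biprod.snd)
  · rw [biprod.lift_desc, ← e, ← e']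
    abel

variable [HasZeroObject C] [HasBinaryBiproducts C]

open scoped ZeroObject in
instance (T : C) : Congruence (factorRel T) where
  comp_left f g g' := by
    rintro ⟨U, a, b, hU, e⟩
    exact ⟨U, f ≫ a, b, hU, by rw [← Preadditive.comp_sub, e, Category.assoc]⟩
  comp_right g h := by
    obtain ⟨U, a, b, hU, e⟩ := h
    exact ⟨U, a, b ≫ g, hU, by rw [← Preadditive.sub_comp, e, Category.assoc]⟩
  equivalence :=
    { refl := fun f => ⟨0, 0, 0, fun _ => (isZero_zero C).eq_of_tgt _ _, by simp⟩
      symm := by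
        rintro f g ⟨U, a, b, hU, e⟩
        exact ⟨U, a, -b, hU, by rw [Preadditive.comp_neg, ← e, neg_sub]⟩
      trans := by
        intro f g h hfg hgh
        obtain ⟨U, a, b, hU, e⟩ := factorRel_add T _ _ _ _ hfg hgh
        exact ⟨U, a, b, hU, by rw [← e]; abel⟩ }

/-- The factor category `C/𝒳_T`. -/
abbrev FactorCategory (T : C) : Type u := CategoryTheory.Quotient (factorRel T)

/-- The additive structure of `C/𝒳_T`, induced by the one of `C`. -/
instance (T : C) : Preadditive (FactorCategory T) :=
  CategoryTheory.Quotient.preadditive (factorRel T) (factorRel_add T)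

/-- The quotient functor `C ⥤ C/𝒳_T`. -/
abbrev quotientFunctor (T : C) : C ⥤ FactorCategory T := CategoryTheory.Quotient.functor (factorRel T)

/-- The regular morphisms of `C/𝒳_T`: those that are both monomorphisms and epimorphisms. -/
def regular (T : C) : MorphismProperty (FactorCategory T) :=
  MorphismProperty.monomorphisms _ ⊓ MorphismProperty.epimorphisms _

/-- The Gabriel-Zisman localisation `(C/𝒳_T)_ℛ` at the class of regular morphisms. -/
abbrev Localisation (T : C) : Type u := (regular T).Localization

/-- The localisation functor `C/𝒳_T ⥤ (C/𝒳_T)_ℛ`. -/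
abbrev localisationFunctor (T : C) : FactorCategory T ⥤ Localisation T := (regular T).Q

/-- The object `X` of `C`, regarded as an object of `(C/𝒳_T)_ℛ`. -/
abbrev toLocalisation (T X : C) : Localisation T :=
  (localisationFunctor T).obj ((quotientFunctor T).obj X)

/-- The ring homomorphism `End_C(T) → End(T)` into the endomorphism ring of `T` in `(C/𝒳_T)_ℛ`,
for an additive structure on `(C/𝒳_T)_ℛ` that makes the localisation functor additive. -/
def endHom (T : C) [Preadditive (Localisation T)] [(localisationFunctor T).Additive] :
    End T →+* End (toLocalisation T T) where
  toFun f := (localisationFunctor T).map ((quotientFunctor T).map f)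
  map_one' := (quotientFunctor T ⋙ localisationFunctor T).map_id T
  map_mul' f g := (quotientFunctor T ⋙ localisationFunctor T).map_comp g f
  map_zero' := (localisationFunctor T).map_zero _ _
  map_add' f g := (localisationFunctor T).map_add
    (f := (quotientFunctor T).map f) (g := (quotientFunctor T).map g)

/-- The functor `Hom(T, -)` from `(C/𝒳_T)_ℛ` to the modules over `End_C(T)ᵒᵖ`. -/
def homLocalisation (T : C) [Preadditive (Localisation T)] [(localisationFunctor T).Additive] :
    Localisation T ⥤ ModuleCat.{max u v} (End T)ᵐᵒᵖ :=
  preadditiveCoyonedaObj (toLocalisation T T) ⋙ ModuleCat.restrictScalars (endHom T).op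

end FactorCategory

section InducedFunctor

lemma isFG_hom (k : Type w) [Field k] {C : Type u} [Category.{v} C] [Preadditive C] [Linear k C]
    [∀ X Y : C, Module.Finite k (X ⟶ Y)] (T X : C) : ModuleCat.isFG _ ((preadditiveCoyonedaObj T).obj X) := by
  have : Module.Finite k (T ⟶ X) := inferInstance
  obtain ⟨s, hs⟩ := this.fg_top
  refine ⟨⟨s, ?_⟩⟩
  let N : Submodule (End T)ᵐᵒᵖ (T ⟶ X) := Submodule.span (End T)ᵐᵒᵖ (s : Set (T ⟶ X))
  let N' : Submodule k (T ⟶ X) :=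
    { carrier := N
      add_mem' := N.add_mem
      zero_mem' := N.zero_mem
      smul_mem' := fun c x hx => by
        have h := N.smul_mem (MulOpposite.op (show End T from c • 𝟙 T)) hx
        have e : MulOpposite.op (show End T from c • 𝟙 T) • x = c • x := by
          change (c • 𝟙 T) ≫ x = c • x
          rw [Linear.smul_comp, Category.id_comp]
        rwa [e] at h }
  have hN' : N' = ⊤ := by
    rw [eq_top_iff, ← hs, Submodule.span_le]
    exact Submodule.subset_span
  change N = ⊤
  rw [eq_top_iff]
  intro x _
  have : x ∈ N' := by rw [hN']; trivial
  exact this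

variable (k : Type w) [Field k] {C : Type u} [Category.{v} C] [Preadditive C] [Linear k C]
  [∀ X Y : C, Module.Finite k (X ⟶ Y)]

/-- The functor `H = Hom_C(T, -) : C ⥤ mod End_C(T)ᵒᵖ`. The composite of two elements of
`End T` is taken in the order of functions, so that `(End T)ᵐᵒᵖ` acts from the left on
`Hom_C(T, X)` by precomposition. -/
def homFunctor (T : C) : C ⥤ FGModuleCat.{v} (End T)ᵐᵒᵖ :=
  (ModuleCat.isFG _).lift (preadditiveCoyonedaObj T) (isFG_hom k T)

lemma homFunctor_eq_of_factorRel (T : C) (X Y : C) (f g : X ⟶ Y) (h : factorRel T f g) :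
    (homFunctor k T).map f = (homFunctor k T).map g := by
  obtain ⟨U, a, b, hU, e⟩ := h
  apply ObjectProperty.hom_ext
  apply ModuleCat.hom_ext
  apply LinearMap.ext
  intro (x : T ⟶ X)
  change x ≫ f = x ≫ g
  rw [← sub_eq_zero, ← Preadditive.comp_sub, e, ← Category.assoc, hU (x ≫ a), zero_comp]

variable [HasZeroObject C] [HasBinaryBiproducts C]

/-- The functor `C/𝒳_T ⥤ mod End_C(T)ᵒᵖ` induced by `H`. -/
def homFactor (T : C) : FactorCategory T ⥤ FGModuleCat.{v} (End T)ᵐᵒᵖ :=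
  CategoryTheory.Quotient.lift (factorRel T) (homFunctor k T) (homFunctor_eq_of_factorRel k T)

end InducedFunctor

section InducedOnLocalisation

variable (k : Type w) [Field k] {C : Type u} [Category.{v} C] [Preadditive C] [Linear k C]
  [∀ X Y : C, Module.Finite k (X ⟶ Y)]
  [HasZeroObject C] [HasShift C ℤ] [∀ n : ℤ, (shiftFunctor C n).Additive]
  [Pretriangulated C]

lemma homFactor_inverts (T : C) : (regular T).IsInvertedBy (homFactor k T) := by
  intro X Y f hf
  obtain ⟨X⟩ := X
  obtain ⟨Y⟩ := Y
  obtain ⟨f, rfl⟩ := (quotientFunctor T).map_surjective (X := X) (Y := Y) f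
  obtain ⟨hm, he⟩ := hf
  rw [MorphismProperty.monomorphisms.iff] at hm
  rw [MorphismProperty.epimorphisms.iff] at he
  change IsIso ((homFunctor k T).map f)
  have key : IsIso ((preadditiveCoyonedaObj T).map f) := by
    rw [ConcreteCategory.isIso_iff_bijective]
    constructor
    · change Function.Injective (fun x : T ⟶ X => x ≫ f)
      obtain ⟨Z, h, g', hT⟩ := Pretriangulated.distinguished_cocone_triangle₁ f
      have h0 : (quotientFunctor T).map h = (quotientFunctor T).map 0 := by
        rw [← cancel_mono ((quotientFunctor T).map f), ← Functor.map_comp, ← Functor.map_comp]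
        have : h ≫ f = 0 := Pretriangulated.comp_distTriang_mor_zero₁₂ _ hT
        rw [this, zero_comp]
      rw [CategoryTheory.Quotient.functor_map_eq_iff] at h0
      obtain ⟨U, a, b, hU, e⟩ := h0
      intro x y hxy
      dsimp at hxy
      rw [← sub_eq_zero, ← Preadditive.sub_comp] at hxy
      obtain ⟨z, hz⟩ : ∃ z : T ⟶ Z, x - y = z ≫ h :=
        Pretriangulated.Triangle.coyoneda_exact₂ _ hT (x - y) hxy
      rw [sub_zero] at e
      rw [← sub_eq_zero, hz, e, ← Category.assoc, hU (z ≫ a), zero_comp]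
    · change Function.Surjective (fun x : T ⟶ X => x ≫ f)
      obtain ⟨Z, g, h', hT⟩ := Pretriangulated.distinguished_cocone_triangle f
      have h0 : (quotientFunctor T).map g = (quotientFunctor T).map 0 := by
        rw [← cancel_epi ((quotientFunctor T).map f), ← Functor.map_comp, ← Functor.map_comp]
        have : f ≫ g = 0 := Pretriangulated.comp_distTriang_mor_zero₁₂ _ hT
        rw [this, comp_zero]
      rw [CategoryTheory.Quotient.functor_map_eq_iff] at h0
      obtain ⟨U, a, b, hU, e⟩ := h0
      rw [sub_zero] at e
      intro y
      have hy : y ≫ g = 0 := by rw [e, ← Category.assoc, hU (y ≫ a), zero_comp]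
      obtain ⟨z, hz⟩ := Pretriangulated.Triangle.coyoneda_exact₂ _ hT y hy
      exact ⟨z, hz.symm⟩
  have : IsIso ((ModuleCat.isFG _).ι.map ((homFunctor k T).map f)) := key
  exact isIso_of_reflects_iso _ (ModuleCat.isFG (End T)ᵐᵒᵖ).ι

/-- The functor `H' : (C/𝒳_T)_ℛ ⥤ mod End_C(T)ᵒᵖ` induced by `H = Hom_C(T, -)` through the
universal properties of the quotient and of the localisation. -/
def inducedHom (T : C) : Localisation T ⥤ FGModuleCat.{v} (End T)ᵐᵒᵖ :=
  Localization.Construction.lift (homFactor k T) (homFactor_inverts k T)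

theorem inducedHom_fac (T : C) :
    quotientFunctor T ⋙ localisationFunctor T ⋙ inducedHom k T = homFunctor k T := by
  rw [inducedHom, Localization.Construction.fac]
  exact CategoryTheory.Quotient.lift_spec _ _ _

theorem inducedHom_unique (T : C) (F : Localisation T ⥤ FGModuleCat.{v} (End T)ᵐᵒᵖ)
    (hF : quotientFunctor T ⋙ localisationFunctor T ⋙ F = homFunctor k T) :
    F = inducedHom k T := by
  apply Localization.Construction.uniq
  apply CategoryTheory.Quotient.lift_unique'
  exact hF.trans (inducedHom_fac k T).symm

end InducedOnLocalisation

end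

end RigidLocalisation

/-!
For `X` the cone of a morphism `Tᵐ ⟶ Tⁿ`, rigidity of `T` makes `Hom(T, Tᵐ) → Hom(T, Tⁿ) →
Hom(T, X) → 0` a free presentation, so `H` is surjective on morphisms out of `X` and every finitely
generated module is of the form `Hom(T, X)` for such an `X`. Completing an approximation `Tⁿ ⟶ X`
to a triangle shows that a morphism killed by `H` factors through `𝒳_T`, so `H` is faithful on
`C/𝒳_T`. The functor induced by `H` on `C/𝒳_T` therefore has a fully faithful left adjoint and is
the localisation at the morphisms it inverts; being faithful, it reflects monomorphisms and
epimorphisms, so these are exactly the regular morphisms and `H'` is an equivalence. It sends `T`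
to the free module of rank one, hence is represented by `T` through evaluation at `𝟙 T`.
-/

namespace RigidLocalisation

section Powers

variable {C : Type u} [Category.{v} C] [Preadditive C]

/-- The map `Hom(T, f)` as a linear map of modules over `End(T)ᵒᵖ`. -/
def postcomp (T : C) {X Y : C} (f : X ⟶ Y) : (T ⟶ X) →ₗ[(End T)ᵐᵒᵖ] (T ⟶ Y) where
  toFun x := x ≫ f
  map_add' _ _ := Preadditive.add_comp _ _ _ _ _ _
  map_smul' _ _ := Category.assoc _ _ _

@[simp]
lemma postcomp_apply (T : C) {X Y : C} (f : X ⟶ Y) (x : T ⟶ X) : postcomp T f x = x ≫ f := rfl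

lemma postcomp_comp (T : C) {X Y Z : C} (f : X ⟶ Y) (g : Y ⟶ Z) :
    postcomp T (f ≫ g) = postcomp T g ∘ₗ postcomp T f :=
  LinearMap.ext fun x => (Category.assoc x f g).symm

lemma postcomp_zero (T X Y : C) : postcomp T (0 : X ⟶ Y) = 0 :=
  LinearMap.ext fun _ => comp_zero

lemma postcomp_eq_of_factorRel {T X Y : C} {f g : X ⟶ Y} (h : factorRel T f g) :
    postcomp T f = postcomp T g := by
  obtain ⟨U, a, b, hU, hfg⟩ := h
  ext x
  rw [← sub_eq_zero, postcomp_apply, postcomp_apply, ← Preadditive.comp_sub, hfg,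
    ← Category.assoc, hU (x ≫ a), zero_comp]

variable [HasFiniteBiproducts C]

/-- The finite power `Tⁿ`; the objects of `add T` are the direct summands of these. -/
noncomputable abbrev power (T : C) (n : ℕ) : C := ⨁ fun _ : Fin n => T

/-- The inclusions `T ⟶ Tⁿ` form a basis of the `End(T)ᵒᵖ`-module `Hom(T, Tⁿ)`. -/
noncomputable def powerBasis (T : C) (n : ℕ) :
    Module.Basis (Fin n) (End T)ᵐᵒᵖ (T ⟶ power T n) :=
  .ofEquivFun
    { toFun := fun x i => MulOpposite.op (x ≫ biproduct.π _ i)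
      invFun := fun r => biproduct.lift fun i => (r i).unop
      map_add' := fun x y => funext fun i =>
        congrArg MulOpposite.op (Preadditive.add_comp _ _ _ x y (biproduct.π _ i))
      map_smul' := fun r x => funext fun i =>
        congrArg MulOpposite.op (Category.assoc r.unop x (biproduct.π _ i))
      left_inv := fun _ => biproduct.hom_ext _ _ fun _ => biproduct.lift_π _ _
      right_inv := fun _ => funext fun _ => congrArg MulOpposite.op (biproduct.lift_π _ _) }

lemma powerBasis_apply (T : C) (n : ℕ) (i : Fin n) :
    powerBasis T n i = biproduct.ι (fun _ : Fin n => T) i := by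
  rw [powerBasis, Module.Basis.coe_ofEquivFun]
  refine biproduct.hom_ext _ _ fun j => (biproduct.lift_π _ _).trans ?_
  obtain rfl | hij := eq_or_ne i j
  · rw [Pi.single_eq_same, biproduct.ι_π_self]
    rfl
  · rw [Pi.single_eq_of_ne hij.symm, biproduct.ι_π_ne _ hij]
    rfl

lemma postcomp_bijective_of_power (T : C) (n : ℕ) (Y : C) :
    Function.Bijective (postcomp T : (power T n ⟶ Y) → _) := by
  refine ⟨fun f g h => biproduct.hom_ext' _ _ fun i => LinearMap.congr_fun h _, fun φ =>
    ⟨biproduct.desc fun i => φ (biproduct.ι (fun _ => T) i), (powerBasis T n).ext fun i => ?_⟩⟩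
  rw [powerBasis_apply, postcomp_apply, biproduct.ι_desc]

lemma exists_power_postcomp_surjective (T X : C) [Module.Finite (End T)ᵐᵒᵖ (T ⟶ X)] :
    ∃ (n : ℕ) (a : power T n ⟶ X), Function.Surjective (postcomp T a) := by
  obtain ⟨n, p, hp⟩ := Module.Finite.exists_fin' (End T)ᵐᵒᵖ (T ⟶ X)
  obtain ⟨a, ha⟩ :=
    (postcomp_bijective_of_power T n X).2 (p ∘ₗ (powerBasis T n).equivFun.toLinearMap)
  exact ⟨n, a, ha ▸ hp.comp (powerBasis T n).equivFun.surjective⟩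

lemma exists_power_presentation (T : C) (M : Type*) [AddCommGroup M] [Module (End T)ᵐᵒᵖ M]
    [Module.FinitePresentation (End T)ᵐᵒᵖ M] :
    ∃ (m n : ℕ) (d : power T m ⟶ power T n) (p : (T ⟶ power T n) →ₗ[(End T)ᵐᵒᵖ] M),
      Function.Exact (postcomp T d) p ∧ Function.Surjective p := by
  obtain ⟨n, m, p, q, hp, hqp⟩ := Module.FinitePresentation.exists_fin' (End T)ᵐᵒᵖ M
  let em := (powerBasis T m).equivFun
  let en := (powerBasis T n).equivFun
  obtain ⟨d, hd⟩ := (postcomp_bijective_of_power T m (power T n)).2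
    (en.symm.toLinearMap ∘ₗ q ∘ₗ em.toLinearMap)
  refine ⟨m, n, d, p ∘ₗ en.toLinearMap, ?_, hp.comp en.surjective⟩
  rw [hd, ← LinearMap.comp_assoc]
  exact em.surjective.comp_exact_iff_exact.2 ((LinearEquiv.conj_exact_iff_exact _ _ en.symm).2 hqp)

end Powers

section Triangles

variable {C : Type u} [Category.{v} C] [Preadditive C] [HasZeroObject C] [HasShift C ℤ]
  [∀ n : ℤ, (shiftFunctor C n).Additive] [Pretriangulated C]

open Pretriangulated

lemma exact_postcomp_mor₁_mor₂ (T : C) {Δ : Triangle C} (hΔ : Δ ∈ distTriang C) :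
    Function.Exact (postcomp T Δ.mor₁) (postcomp T Δ.mor₂) := by
  refine fun x => ⟨fun hx => ?_, ?_⟩
  · obtain ⟨y, hy⟩ := Δ.coyoneda_exact₂ hΔ x hx
    exact ⟨y, hy.symm⟩
  · rintro ⟨y, rfl⟩
    rw [postcomp_apply, postcomp_apply, Category.assoc, comp_distTriang_mor_zero₁₂ Δ hΔ, comp_zero]

lemma postcomp_mor₂_surjective (T : C) {Δ : Triangle C} (hΔ : Δ ∈ distTriang C)
    (h : perp T (Δ.obj₁⟦(1 : ℤ)⟧)) : Function.Surjective (postcomp T Δ.mor₂) := by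
  intro x
  obtain ⟨y, hy⟩ := Δ.coyoneda_exact₃ hΔ x (h _)
  exact ⟨y, hy.symm⟩

lemma perp_obj₃_of_postcomp_mor₁_surjective (T : C) {Δ : Triangle C} (hΔ : Δ ∈ distTriang C)
    (h : perp T (Δ.obj₁⟦(1 : ℤ)⟧)) (h₁ : Function.Surjective (postcomp T Δ.mor₁)) :
    perp T Δ.obj₃ := by
  intro x
  obtain ⟨y, rfl⟩ := postcomp_mor₂_surjective T hΔ h x
  exact (exact_postcomp_mor₁_mor₂ T hΔ y).2 (h₁ y)

variable {T : C}

lemma IsRigid.perp_shift_power (hT : IsRigid T) (n : ℕ) : perp T ((power T n)⟦(1 : ℤ)⟧) := by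
  intro f
  have id_eq : 𝟙 ((power T n)⟦(1 : ℤ)⟧) = ∑ i, (biproduct.π (fun _ : Fin n => T) i)⟦(1 : ℤ)⟧' ≫
      (biproduct.ι (fun _ : Fin n => T) i)⟦(1 : ℤ)⟧' := by
    simp_rw [← Functor.map_comp]
    rw [← Functor.map_sum, biproduct.total, CategoryTheory.Functor.map_id]
  rw [← Category.comp_id f, id_eq, Preadditive.comp_sum]
  refine Finset.sum_eq_zero fun i _ => ?_
  rw [← Category.assoc, hT (f ≫ _), zero_comp]

lemma IsRigid.factorRel_iff (hT : IsRigid T) {X Y : C} [Module.Finite (End T)ᵐᵒᵖ (T ⟶ X)]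
    {f g : X ⟶ Y} : factorRel T f g ↔ postcomp T f = postcomp T g := by
  refine ⟨postcomp_eq_of_factorRel, fun h => ?_⟩
  obtain ⟨n, a, ha⟩ := exists_power_postcomp_surjective T X
  obtain ⟨U, c, _, hΔ⟩ := distinguished_cocone_triangle a
  have hfg : a ≫ f = a ≫ g := (postcomp_bijective_of_power T n Y).1 <| by
    rw [postcomp_comp, postcomp_comp, h]
  obtain ⟨b, hb⟩ := Triangle.yoneda_exact₂ _ hΔ (f - g)
    (show a ≫ (f - g) = 0 by rw [Preadditive.comp_sub, hfg, sub_self])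
  exact ⟨U, c, b, perp_obj₃_of_postcomp_mor₁_surjective T hΔ (hT.perp_shift_power n) ha, hb⟩

/-- `X` is the cone of a morphism `Tᵐ ⟶ Tⁿ`, hence an object of `add T * Σ(add T)`. -/
def IsPowerCone (T X : C) : Prop :=
  ∃ (m n : ℕ) (d : power T m ⟶ power T n) (c : power T n ⟶ X) (h : X ⟶ (power T m)⟦(1 : ℤ)⟧),
    Triangle.mk d c h ∈ distTriang C

lemma IsPowerCone.postcomp_surjective (hT : IsRigid T) {X : C} (hX : IsPowerCone T X) (Y : C) :
    Function.Surjective (postcomp T : (X ⟶ Y) → _) := by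
  intro φ
  obtain ⟨m, n, d, c, _, hΔ⟩ := hX
  obtain ⟨u, hu⟩ := (postcomp_bijective_of_power T n Y).2 (φ ∘ₗ postcomp T c)
  have hdc : postcomp T c ∘ₗ postcomp T d = 0 :=
    (exact_postcomp_mor₁_mor₂ T hΔ).linearMap_comp_eq_zero
  have hdu : d ≫ u = 0 := (postcomp_bijective_of_power T m Y).1 <| by
    rw [postcomp_comp, hu, LinearMap.comp_assoc, hdc, LinearMap.comp_zero, postcomp_zero]
  obtain ⟨f, rfl⟩ : ∃ f, u = c ≫ f := Triangle.yoneda_exact₂ _ hΔ u hdu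
  rw [postcomp_comp] at hu
  exact ⟨f, (LinearMap.cancel_right (postcomp_mor₂_surjective T hΔ (hT.perp_shift_power m))).1 hu⟩

lemma IsRigid.exists_isPowerCone_linearEquiv (hT : IsRigid T) (M : Type*) [AddCommGroup M]
    [Module (End T)ᵐᵒᵖ M] [Module.FinitePresentation (End T)ᵐᵒᵖ M] :
    ∃ X : C, IsPowerCone T X ∧ Nonempty (M ≃ₗ[(End T)ᵐᵒᵖ] (T ⟶ X)) := by
  obtain ⟨m, n, d, p, hdp, hp⟩ := exists_power_presentation T M
  obtain ⟨X, c, h, hΔ⟩ := distinguished_cocone_triangle d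
  have hdc : Function.Exact (postcomp T d) (postcomp T c) := exact_postcomp_mor₁_mor₂ T hΔ
  have hc : Function.Surjective (postcomp T c) :=
    postcomp_mor₂_surjective T hΔ (hT.perp_shift_power m)
  exact ⟨X, ⟨m, n, d, c, h, hΔ⟩,
    ⟨(hdp.linearEquivOfSurjective hp).symm ≪≫ₗ hdc.linearEquivOfSurjective hc⟩⟩

end Triangles

section Localisation

/-- If every object of the target is the image of an object on whose outgoing morphisms `G` is
bijective, these objects assemble to a fully faithful left adjoint of `G`. -/
lemma isLocalization_of_exists_iso {D E : Type*} [Category* D] [Category* E] (G : D ⥤ E)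
    (h : ∀ M : E, ∃ X : D, Nonempty (M ≅ G.obj X) ∧
      ∀ Y, Function.Bijective (G.map : (X ⟶ Y) → (G.obj X ⟶ G.obj Y))) :
    G.IsLocalization ((MorphismProperty.isomorphisms E).inverseImage G) := by
  choose X e bij using h
  let i (M : E) : M ≅ G.obj (X M) := (e M).some
  let adj := Adjunction.adjunctionOfEquivLeft (G := G)
    (fun M Y => (Equiv.ofBijective _ (bij M Y)).trans (i M).symm.homFromEquiv)
    (fun M Y Y' g f => by simp)
  have (M : E) : IsIso (adj.unit.app M) := by
    have unit_app : adj.unit.app M = (i M).hom := by simp [adj]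
    rw [unit_app]
    infer_instance
  have : IsIso adj.unit := NatIso.isIso_of_isIso_app _
  have := adj.fullyFaithfulLOfIsIsoUnit.full
  have := adj.fullyFaithfulLOfIsIsoUnit.faithful
  exact adj.isLocalization_rightAdjoint'

lemma exists_preadditive_of_comp_fullyFaithful {D D' E : Type*} [Category* D] [Category* D']
    [Category* E] [Preadditive D] [Preadditive E] (L : D ⥤ D') (F : D' ⥤ E) [F.Full] [F.Faithful]
    [(L ⋙ F).Additive] : ∃ _ : Preadditive D', L.Additive := by
  let hF := Functor.FullyFaithful.ofFullyFaithful F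
  let := Preadditive.ofFullyFaithful hF
  have := hF.additive_ofFullyFaithful
  exact ⟨inferInstance, Functor.additive_of_comp_faithful L F⟩

/-- Addition in a category with finite products is determined by the products. -/
lemma additive_of_isEquivalence_of_essSurj {D D' E : Type*} [Category* D] [Category* D']
    [Category* E] [Preadditive D] [Preadditive D'] [Preadditive E] [HasFiniteProducts D]
    (L : D ⥤ D') [L.Additive] [L.EssSurj] (F : D' ⥤ E) [F.IsEquivalence] : F.Additive := by
  have := L.hasFiniteProducts_of_additive_of_essSurj
  exact F.additive_of_preserves_binary_products

end Localisation

section Representable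

variable {R : Type*} [Ring R] {D : Type u} [Category.{max w v} D]
  (F : D ⥤ ModuleCat.{v} R) [F.Full] [F.Faithful] {t : D} {u : F.obj t}

lemma map_apply_bijective_of_smul_bijective (hu : Function.Bijective fun r : R => r • u) (X : D) :
    Function.Bijective fun f : t ⟶ X => F.map f u := by
  refine ⟨fun f g h => F.map_injective (ModuleCat.hom_ext (LinearMap.ext fun x => ?_)), fun y => ?_⟩
  · obtain ⟨r, rfl⟩ := hu.2 x
    exact (map_smul _ r u).trans ((congrArg (r • ·) h).trans (map_smul _ r u).symm)
  · let e : R ≃ₗ[R] F.obj t := .ofBijective (LinearMap.toSpanSingleton R _ u) hu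
    obtain ⟨f, hf⟩ := F.map_surjective
      (ModuleCat.ofHom (LinearMap.toSpanSingleton R (F.obj X) y ∘ₗ e.symm.toLinearMap))
    have he : e.symm u = 1 := (LinearEquiv.symm_apply_eq e).2 (one_smul R u).symm
    refine ⟨f, ?_⟩
    simp [hf, he]

/-- Evaluation at a generator `u` of the free module `F(t)` identifies `F` with `Hom(t, -)`; here
`R` acts on `Hom(t, X)` through a ring homomorphism `θ` compatible with the action on `u`. -/
noncomputable def isoCoyonedaRestrictScalars [Preadditive D] [F.Additive]
    (hu : Function.Bijective fun r : R => r • u) (θ : R →+* (End t)ᵐᵒᵖ)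
    (hθ : ∀ r, F.map (θ r).unop u = r • u) :
    F ⋙ ModuleCat.uliftFunctor.{w} R ≅
      preadditiveCoyonedaObj t ⋙ ModuleCat.restrictScalars θ :=
  (NatIso.ofComponents
    (fun X => LinearEquiv.toModuleIso <|
      (LinearEquiv.ofBijective
        (M := (preadditiveCoyonedaObj t ⋙ ModuleCat.restrictScalars θ).obj X)
        { toFun := fun f : t ⟶ X => F.map f u
          map_add' := fun f g =>
            congrArg (fun φ : F.obj t ⟶ F.obj X => φ u) (F.map_add (f := f) (g := g))
          map_smul' := fun r f => by
            refine (congrArg (fun φ : F.obj t ⟶ F.obj X => φ u)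
              (F.map_comp (θ r).unop f)).trans ?_
            exact (congrArg (F.map f) (hθ r)).trans (map_smul (F.map f).hom r u) }
        (map_apply_bijective_of_smul_bijective F hu X)).trans ULift.moduleEquiv.symm)
    fun g => ModuleCat.hom_ext <| LinearMap.ext fun f => ULift.ext _ _ <|
      congrArg (fun φ : F.obj t ⟶ _ => φ u) (F.map_comp f g)).symm

end Representable

lemma essImage_isFG_ι_comp_uliftFunctor (R : Type u) [Ring R] [Small.{v} R] :
    ((ModuleCat.isFG.{v} R).ι ⋙ ModuleCat.uliftFunctor.{w} R).essImage =
      ModuleCat.isFG.{max v w} R := by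
  ext M
  constructor
  · rintro ⟨N, ⟨e⟩⟩
    exact Module.Finite.equiv (M := N.obj) (ULift.moduleEquiv.symm ≪≫ₗ e.toLinearEquiv)
  · intro (hM : Module.Finite R M)
    obtain ⟨n, f, hf⟩ := Module.Finite.exists_fin' R M
    have : Small.{v} M := small_of_surjective hf
    have : Module.Finite R (Shrink.{v} M) := .equiv (Shrink.linearEquiv R M).symm
    let e : ULift.{w} (Shrink.{v} M) ≃ₗ[R] M := ULift.moduleEquiv ≪≫ₗ Shrink.linearEquiv R M
    exact ⟨FGModuleCat.of R (Shrink.{v} M), ⟨e.toModuleIso⟩⟩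

section HomFiniteCategory

variable {C : Type u} [Category.{v} C] [Preadditive C] (T : C)

lemma smul_id_bijective : Function.Bijective fun r : (End T)ᵐᵒᵖ => r • 𝟙 T := by
  have smul_id : (fun r : (End T)ᵐᵒᵖ => r • 𝟙 T) = MulOpposite.unop :=
    funext fun r => Category.comp_id r.unop
  exact smul_id ▸ MulOpposite.unop_bijective

instance [HasZeroObject C] [HasBinaryBiproducts C] : (quotientFunctor T).Additive where

lemma isNoetherianRing_end_op (k : Type*) [CommRing k] [IsNoetherianRing k] [Linear k C]
    [Module.Finite k (T ⟶ T)] : IsNoetherianRing (End T)ᵐᵒᵖ := by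
  have : Module.Finite k (End T) := inferInstanceAs (Module.Finite k (T ⟶ T))
  have : Module.Finite k (End T)ᵐᵒᵖ := .equiv (MulOpposite.opLinearEquiv k)
  exact .of_finite k _

instance [HasZeroObject C] [HasBinaryBiproducts C] (k : Type w) [Field k] [Linear k C]
    [∀ X Y : C, Module.Finite k (X ⟶ Y)] : (homFactor k T).Additive where
  map_add {X Y} f g := by
    obtain ⟨X⟩ := X
    obtain ⟨Y⟩ := Y
    obtain ⟨f, rfl⟩ := (quotientFunctor T).map_surjective (X := X) (Y := Y) f
    obtain ⟨g, rfl⟩ := (quotientFunctor T).map_surjective (X := X) (Y := Y) g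
    exact FGModuleCat.hom_ext <| LinearMap.ext fun x : T ⟶ X => Preadditive.comp_add _ _ _ x f g

end HomFiniteCategory

section Equivalence

variable (k : Type w) [Field k] {C : Type u} [Category.{v} C] [Preadditive C] [Linear k C]
  [∀ X Y : C, Module.Finite k (X ⟶ Y)] [HasZeroObject C] [HasShift C ℤ]
  [∀ n : ℤ, (shiftFunctor C n).Additive] [Pretriangulated C] {T : C}

lemma homFactor_faithful (hT : IsRigid T) : (homFactor k T).Faithful where
  map_injective {X Y} f g h := by
    obtain ⟨X⟩ := X
    obtain ⟨Y⟩ := Y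
    obtain ⟨f, rfl⟩ := (quotientFunctor T).map_surjective (X := X) (Y := Y) f
    obtain ⟨g, rfl⟩ := (quotientFunctor T).map_surjective (X := X) (Y := Y) g
    have : Module.Finite (End T)ᵐᵒᵖ (T ⟶ X) := isFG_hom k T X
    rw [CategoryTheory.Quotient.functor_map_eq_iff, hT.factorRel_iff]
    exact congrArg (fun φ => φ.hom.hom) h

lemma IsPowerCone.homFactor_map_bijective (hT : IsRigid T) {X : C} (hX : IsPowerCone T X)
    (Y : FactorCategory T) :
    Function.Bijective ((homFactor k T).map : ((quotientFunctor T).obj X ⟶ Y) → _) := by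
  have := homFactor_faithful k hT
  refine ⟨(homFactor k T).map_injective, fun φ => ?_⟩
  obtain ⟨Y⟩ := Y
  obtain ⟨f, hf⟩ := hX.postcomp_surjective hT Y φ.hom.hom
  exact ⟨(quotientFunctor T).map f, FGModuleCat.hom_ext hf⟩

lemma exists_isPowerCone_iso_homFactor_obj (hT : IsRigid T) (M : FGModuleCat.{v} (End T)ᵐᵒᵖ) :
    ∃ X : C, IsPowerCone T X ∧ Nonempty (M ≅ (homFactor k T).obj ((quotientFunctor T).obj X)) := by
  have := isNoetherianRing_end_op T k
  have := Module.finitePresentation_of_finite (End T)ᵐᵒᵖ M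
  obtain ⟨X, hX, ⟨e⟩⟩ := hT.exists_isPowerCone_linearEquiv M
  exact ⟨X, hX, ⟨(ModuleCat.isFG _).isoMk e.toModuleIso⟩⟩

lemma regular_eq_inverseImage (hT : IsRigid T) :
    regular T = (MorphismProperty.isomorphisms _).inverseImage (homFactor k T) := by
  have := homFactor_faithful k hT
  refine le_antisymm (fun X Y f hf => homFactor_inverts k T f hf) fun X Y f hf => ?_
  have : IsIso ((homFactor k T).map f) := hf
  exact ⟨(homFactor k T).mono_of_mono_map inferInstance,
    (homFactor k T).epi_of_epi_map inferInstance⟩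

lemma homFactor_isLocalization (hT : IsRigid T) :
    (homFactor k T).IsLocalization (regular T) := by
  rw [regular_eq_inverseImage k hT]
  refine isLocalization_of_exists_iso _ fun M => ?_
  obtain ⟨X, hX, e⟩ := exists_isPowerCone_iso_homFactor_obj k hT M
  exact ⟨_, e, hX.homFactor_map_bijective k hT⟩

lemma inducedHom_isEquivalence (hT : IsRigid T) : (inducedHom k T).IsEquivalence :=
  (homFactor_isLocalization k hT).isEquivalence

include k in
lemma exists_preadditive_localisation (hT : IsRigid T) :
    ∃ _ : Preadditive (Localisation T), (localisationFunctor T).Additive := by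
  have := inducedHom_isEquivalence k hT
  have : (localisationFunctor T ⋙ inducedHom k T).Additive :=
    inferInstanceAs (homFactor k T).Additive
  exact exists_preadditive_of_comp_fullyFaithful (localisationFunctor T) (inducedHom k T)

variable [Preadditive (Localisation T)] [(localisationFunctor T).Additive]

lemma inducedHom_additive (hT : IsRigid T) : (inducedHom k T).Additive := by
  have := inducedHom_isEquivalence k hT
  have : (localisationFunctor T).EssSurj := Localization.essSurj _ (regular T)
  exact additive_of_isEquivalence_of_essSurj (quotientFunctor T ⋙ localisationFunctor T)
    (inducedHom k T)

/-- `H'` is the functor represented by `T` in the localisation. -/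
noncomputable def inducedHomIso (hT : IsRigid T) :
    inducedHom k T ⋙ (ModuleCat.isFG _).ι ⋙ ModuleCat.uliftFunctor.{u} _ ≅ homLocalisation T :=
  have := inducedHom_isEquivalence k hT
  have := inducedHom_additive k hT
  isoCoyonedaRestrictScalars (inducedHom k T ⋙ (ModuleCat.isFG _).ι)
    (t := toLocalisation T T) (u := (𝟙 T : T ⟶ T))
    (smul_id_bijective T) (endHom T).op
    fun r => (Category.id_comp r.unop).trans (Category.comp_id r.unop).symm

end Equivalence

end RigidLocalisation

open RigidLocalisation in
theorem lemma7p3_general (k : Type w) [Field k] (C : Type u) [Category.{v} C] [Preadditive C]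
    [Linear k C] [HasZeroObject C] [HasShift C ℤ] [∀ n : ℤ, (shiftFunctor C n).Additive]
    [Pretriangulated C] [∀ X Y : C, Module.Finite k (X ⟶ Y)] (T : C) (hT : IsRigid T) :
    (∃ _ : Preadditive (Localisation T), (localisationFunctor T).Additive) ∧
    (∀ [Preadditive (Localisation T)] [(localisationFunctor T).Additive],
      Nonempty (inducedHom k T ⋙ (ModuleCat.isFG _).ι ⋙ ModuleCat.uliftFunctor.{u} _ ≅
        homLocalisation T) ∧
      (homLocalisation T).Full ∧ (homLocalisation T).Faithful ∧
      (homLocalisation T).essImage = ModuleCat.isFG _) ∧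
    (inducedHom k T).IsEquivalence := by
  have equivalence := inducedHom_isEquivalence k hT
  refine ⟨exists_preadditive_localisation k hT, ?_, equivalence⟩
  intro _ _
  let e := inducedHomIso k hT
  refine ⟨⟨e⟩, .of_iso e, .of_iso e, ?_⟩
  rw [← Functor.essImage_eq_of_natIso e, Functor.essImage_comp_of_essSurj,
    essImage_isFG_ι_comp_uliftFunctor]

open RigidLocalisation in
theorem lemma7p3 (k : Type w) [Field k] (C : Type u) [Category.{v} C] [EssentiallySmall.{v} C]
    [Preadditive C] [Linear k C] [HasZeroObject C] [HasShift C ℤ]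
    [∀ n : ℤ, (shiftFunctor C n).Additive] [∀ n : ℤ, (shiftFunctor C n).Linear k]
    [Pretriangulated C] [IsTriangulated C]
    [∀ X Y : C, Module.Finite k (X ⟶ Y)]
    (hKS : IsKrullSchmidt C) (hSerre : HasSerreDuality k C)
    (T : C) (hT : IsRigid T) :
    (∃ _ : Preadditive (Localisation T), (localisationFunctor T).Additive) ∧
    (∀ [Preadditive (Localisation T)] [(localisationFunctor T).Additive],
      Nonempty (inducedHom k T ⋙ (ModuleCat.isFG _).ι ⋙ ModuleCat.uliftFunctor.{u} _ ≅
        homLocalisation T) ∧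
      (homLocalisation T).Full ∧ (homLocalisation T).Faithful ∧
      (homLocalisation T).essImage = ModuleCat.isFG _) ∧
    (inducedHom k T).IsEquivalence :=
  lemma7p3_general k C T hT
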